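/- Let $\mathbb{H}=\{x+iy : y>0\}$ be the hyperbolic upper half-plane, whose geodesic lines are the vertical lines and the semicircles centred on the real axis. For $g=\begin{pmatrix}a&b\\c&d\end{pmatrix}\in \mathrm{SL}_2(\mathbb{R})$ let $T_g(z)=\frac{az+b}{cz+d}$, so that $T$ is a homomorphism from $\mathrm{SL}_2(\mathbb{R})$ to the group of bijections of $\mathbb{H}$. The reflection in the $y$-axis is $z\mapsto -\bar z$, and the reflection in a geodesic line $\ell$ is $R_\ell=T_g^{-1}\circ(z\mapsto-\bar z)\circ T_g$ for any $g\in\mathrm{SL}_2(\mathbb{R})$ such that $T_g(\ell)$ is the $y$-axis. Theorem. Let $\mathcal{T}$ be a geodesic triangle in $\mathbb{H}$ (its three vertices lie in $\mathbb{H}$ and not on a common geodesic line) with interior angles $\frac{\pi}{n_1},\frac{\pi}{n_2},\frac{\pi}{n_3}$, where $n_1,n_2,n_3$ are positive integers. Let $R_1,R_2,R_3$ be the reflections in the geodesic lines containing the sides of $\mathcal{T}$, let $\Lambda$ be the group generated by $R_1,R_2,R_3$, and let $\Lambda_0\subset\Lambda$ be the subgroup of all products of an even number of the reflections $R_i$.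 Then $\Lambda_0$ has index two in $\Lambda$, $\Lambda_0\subset T_{\mathrm{SL}_2(\mathbb{R})}$, and the group $$\Gamma=T^{-1}(\Lambda_0)\subset \mathrm{SL}_2(\mathbb{R})$$ is a cocompact lattice in $\mathrm{SL}_2(\mathbb{R})$: it is a discrete subgroup, the space $\Gamma\backslash \mathrm{SL}_2(\mathbb{R})$ is compact, and $\Gamma\backslash \mathrm{SL}_2(\mathbb{R})$ has finite volume, i.e. there is a Borel set $F$ of finite Haar measure such that $\mathrm{SL}_2(\mathbb{R})$ is the disjoint union of the sets $\gamma F$, $\gamma\in\Gamma$. -/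

import Mathlib

open UpperHalfPlane MeasureTheory
open scoped MatrixGroups ComplexConjugate

noncomputable section

namespace TriangleGroup

/-! ### Geodesics of the hyperbolic plane -/

/-- The `y`-axis in the upper half-plane. -/
def yAxis : Set ℍ := {z | z.re = 0}

/-- The geodesic lines of `ℍ`: vertical lines and semicircles centred on the real axis. -/
def IsGeodesicLine (ℓ : Set ℍ) : Prop :=
  (∃ a : ℝ, ℓ = {z : ℍ | z.re = a}) ∨
    ∃ c r : ℝ, 0 < r ∧ ℓ = {z : ℍ | ‖(z : ℂ) - c‖ = r}

/-- The point of the real axis with the same Euclidean distance to `p` and to `q`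
(meaningful when `p.re ≠ q.re`). -/
def center (p q : ℍ) : ℝ := (‖(q : ℂ)‖ ^ 2 - ‖(p : ℂ)‖ ^ 2) / (2 * (q.re - p.re))

/-- The geodesic line through two distinct points `p` and `q`. -/
def geodesicThrough (p q : ℍ) : Set ℍ :=
  if p.re = q.re then {z : ℍ | z.re = p.re}
  else {z : ℍ | ‖(z : ℂ) - center p q‖ = ‖(p : ℂ) - center p q‖}

/-- A tangent vector at `p` of the geodesic segment from `p` to `q`, pointing from `p` towards `q`.
On a semicircle it is the radius vector at `p` turned by a right angle,
counterclockwise if `q` lies to the left of `p` and clockwise if `q` lies to the right of `p`. -/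
def tangentVector (p q : ℍ) : ℂ :=
  if p.re = q.re then (q.im - p.im : ℝ) * Complex.I
  else (p.re - q.re : ℝ) * (Complex.I * ((p : ℂ) - center p q))

theorem isGeodesicLine_geodesicThrough (p q : ℍ) : IsGeodesicLine (geodesicThrough p q) := by
  unfold geodesicThrough
  split_ifs with h
  · exact Or.inl ⟨p.re, rfl⟩
  · refine Or.inr ⟨center p q, ‖(p : ℂ) - center p q‖, ?_, rfl⟩
    rw [norm_pos_iff]
    intro h0
    have := congrArg Complex.im h0
    simp at this
    exact p.im_pos.ne' this

theorem left_mem_geodesicThrough (p q : ℍ) : p ∈ geodesicThrough p q := by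
  unfold geodesicThrough
  split_ifs with h <;> simp

theorem right_mem_geodesicThrough (p q : ℍ) : q ∈ geodesicThrough p q := by
  unfold geodesicThrough
  split_ifs with h
  · simp [h]
  · simp only [Set.mem_ofPred_eq]
    rw [← sq_eq_sq₀ (norm_nonneg _) (norm_nonneg _)]
    have h' : q.re - p.re ≠ 0 := sub_ne_zero.mpr (Ne.symm h)
    have hc : center p q * (2 * (q.re - p.re)) = ‖(q : ℂ)‖ ^ 2 - ‖(p : ℂ)‖ ^ 2 := by
      unfold center
      field_simp
    simp only [← Complex.normSq_eq_norm_sq, Complex.normSq_apply, Complex.sub_re, Complex.sub_im,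
      Complex.ofReal_re, Complex.ofReal_im, UpperHalfPlane.coe_re, UpperHalfPlane.coe_im] at hc ⊢
    linarith

/-! ### Möbius transformations and reflections -/

/-- The homomorphism `g ↦ T_g`, where `T_g z = (a z + b) / (c z + d)`. -/
def T : SL(2, ℝ) →* Equiv.Perm ℍ := MulAction.toPermHom SL(2, ℝ) ℍ

theorem coe_T_apply (g : SL(2, ℝ)) (z : ℍ) :
    ((T g z : ℍ) : ℂ) =
      ((g 0 0 : ℝ) * (z : ℂ) + (g 0 1 : ℝ)) / ((g 1 0 : ℝ) * (z : ℂ) + (g 1 1 : ℝ)) :=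
  UpperHalfPlane.coe_specialLinearGroup_apply g z

/-- The reflection `z ↦ -conj z` in the `y`-axis. -/
def yAxisReflection : Equiv.Perm ℍ := MulAction.toPerm UpperHalfPlane.J

theorem coe_yAxisReflection_apply (z : ℍ) : ((yAxisReflection z : ℍ) : ℂ) = -conj (z : ℂ) :=
  UpperHalfPlane.coe_J_smul z

open Classical in
/-- The reflection in the geodesic line `ℓ`: it is `T_g⁻¹ R T_g`, where `R` is the reflection in the
`y`-axis and `g ∈ SL(2, ℝ)` satisfies `T_g ℓ = y`-axis. By `exists_image_eq_yAxis` such a `g` exists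
for every geodesic line, and by `reflection_eq` the choice of `g` does not matter. -/
def reflection (ℓ : Set ℍ) : Equiv.Perm ℍ :=
  if h : ∃ g : SL(2, ℝ), T g '' ℓ = yAxis then (T h.choose)⁻¹ * yAxisReflection * T h.choose else 1

theorem exists_image_eq_yAxis {ℓ : Set ℍ} (hℓ : IsGeodesicLine ℓ) :
    ∃ g : SL(2, ℝ), T g '' ℓ = yAxis := by
  have key : ∀ a b c d : ℝ, a * d - b * c = 1 →
      (∀ z : ℍ, z ∈ ℓ ↔ (((a : ℂ) * z + b) / ((c : ℂ) * z + d)).re = 0) →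
      ∃ g : SL(2, ℝ), T g '' ℓ = yAxis := by
    intro a b c d hdet hg'
    let g : SL(2, ℝ) := ⟨!![a, b; c, d], by rw [Matrix.det_fin_two_of, hdet]⟩
    have hg : ∀ z : ℍ, z ∈ ℓ ↔ ((T g z : ℍ) : ℂ).re = 0 := by
      intro z
      rw [coe_T_apply]
      exact hg' z
    refine ⟨g, ?_⟩
    ext w
    constructor
    · rintro ⟨z, hz, rfl⟩
      exact (hg z).1 hz
    · intro hw
      refine ⟨(T g).symm w, (hg _).2 ?_, by simp⟩
      simpa using! hw
  rcases hℓ with ⟨a, rfl⟩ | ⟨c, r, hr, rfl⟩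
  · refine key 1 (-a) 0 1 (by ring) fun z => ?_
    simp [← sub_eq_add_neg, sub_eq_zero]
  · have hs : 0 < √(2 * r) := Real.sqrt_pos.2 (by linarith)
    have hs2 : √(2 * r) * √(2 * r) = 2 * r := Real.mul_self_sqrt (by linarith)
    refine key (1 / √(2 * r)) (-(c + r) / √(2 * r)) (1 / √(2 * r)) (-(c - r) / √(2 * r)) ?_
      fun z => ?_
    · have h1 : 1 / √(2 * r) * (-(c - r) / √(2 * r)) - -(c + r) / √(2 * r) * (1 / √(2 * r)) =
          2 * r / (√(2 * r) * √(2 * r)) := by ring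
      rw [h1, hs2, div_self (by linarith)]
    · have hsC : ((√(2 * r) : ℝ) : ℂ) ≠ 0 := by exact_mod_cast hs.ne'
      have hden : (z : ℂ) - (c - r : ℝ) ≠ 0 := by
        intro h0
        have := congrArg Complex.im h0
        simp at this
        exact z.im_pos.ne' this
      have e : (((1 / √(2 * r) : ℝ) : ℂ) * z + ((-(c + r) / √(2 * r) : ℝ) : ℂ)) /
          (((1 / √(2 * r) : ℝ) : ℂ) * z + ((-(c - r) / √(2 * r) : ℝ) : ℂ)) =
          ((z : ℂ) - (c + r : ℝ)) / ((z : ℂ) - (c - r : ℝ)) := by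
        have e1 : ((1 / √(2 * r) : ℝ) : ℂ) * z + ((-(c + r) / √(2 * r) : ℝ) : ℂ) =
            ((z : ℂ) - (c + r : ℝ)) / (√(2 * r) : ℝ) := by
          push_cast; ring
        have e2 : ((1 / √(2 * r) : ℝ) : ℂ) * z + ((-(c - r) / √(2 * r) : ℝ) : ℂ) =
            ((z : ℂ) - (c - r : ℝ)) / (√(2 * r) : ℝ) := by
          push_cast; ring
        rw [e1, e2, div_div_div_cancel_right₀ hsC]
      rw [e, Complex.div_re, ← add_div, div_eq_zero_iff]
      have hn : Complex.normSq ((z : ℂ) - (c - r : ℝ)) ≠ 0 := by simpa using! hden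
      simp only [hn, or_false, Set.mem_ofPred_eq]
      rw [← sq_eq_sq₀ (norm_nonneg _) hr.le, ← Complex.normSq_eq_norm_sq, Complex.normSq_apply]
      simp only [Complex.sub_re, Complex.sub_im, Complex.ofReal_re, Complex.ofReal_im]
      constructor <;> intro h <;> linarith

/-- A Möbius transformation preserving the `y`-axis commutes with the reflection in it. -/
theorem commute_of_image_yAxis {k : SL(2, ℝ)} (hk : T k '' yAxis = yAxis) :
    T k * yAxisReflection = yAxisReflection * T k := by
  have hre : ∀ y : ℝ, 0 < y → k 0 1 * k 1 1 + k 0 0 * k 1 0 * y ^ 2 = 0 := by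
    intro y hy
    let z : ℍ := ⟨⟨0, y⟩, hy⟩
    have hz : T k z ∈ yAxis := hk ▸ Set.mem_image_of_mem _ (show z ∈ yAxis from rfl)
    have h0 : ((T k z : ℍ) : ℂ).re = 0 := hz
    have hden : Complex.normSq (((k 1 0 : ℝ) : ℂ) * (z : ℂ) + ((k 1 1 : ℝ) : ℂ)) ≠ 0 := by
      have := UpperHalfPlane.denom_ne_zero (k : GL (Fin 2) ℝ) z
      simpa [UpperHalfPlane.denom] using! this
    rw [coe_T_apply, Complex.div_re, ← add_div, div_eq_zero_iff, or_iff_left hden] at h0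
    simp [z] at h0
    linarith
  have hdet : k 0 0 * k 1 1 - k 0 1 * k 1 0 = 1 := by
    have := k.det_coe
    rwa [Matrix.det_fin_two] at this
  have h1 := hre 1 one_pos
  have h2 := hre 2 two_pos
  have hac : k 0 0 * k 1 0 = 0 := by linarith
  have hbd : k 0 1 * k 1 1 = 0 := by linarith
  ext z
  simp only [Equiv.Perm.coe_mul, Function.comp_apply]
  rw [coe_T_apply, coe_yAxisReflection_apply, coe_yAxisReflection_apply, coe_T_apply]
  rcases mul_eq_zero.1 hac with ha | hc
  · have hd : k 1 1 = 0 := by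
      rcases mul_eq_zero.1 hbd with hb | hd
      · rw [ha, hb] at hdet; simp at hdet
      · exact hd
    simp [ha, hd, div_neg]
  · have hb : k 0 1 = 0 := by
      rcases mul_eq_zero.1 hbd with hb | hd
      · exact hb
      · rw [hc, hd] at hdet; simp at hdet
    simp [hc, hb, neg_div]

theorem reflection_eq {ℓ : Set ℍ} {g : SL(2, ℝ)} (hg : T g '' ℓ = yAxis) :
    reflection ℓ = (T g)⁻¹ * yAxisReflection * T g := by
  have h : ∃ g : SL(2, ℝ), T g '' ℓ = yAxis := ⟨g, hg⟩
  have hdef : reflection ℓ = (T h.choose)⁻¹ * yAxisReflection * T h.choose := dif_pos h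
  have hk : T (g * h.choose⁻¹) '' yAxis = yAxis := by
    calc T (g * h.choose⁻¹) '' yAxis = T (g * h.choose⁻¹) '' (T h.choose '' ℓ) := by
          rw [h.choose_spec]
      _ = yAxis := by
          rw [← Set.image_comp, ← Equiv.Perm.coe_mul, ← map_mul, inv_mul_cancel_right, hg]
  have hcomm := commute_of_image_yAxis hk
  rw [map_mul, map_inv] at hcomm
  rw [hdef]
  generalize T h.choose = a at *
  calc a⁻¹ * yAxisReflection * a
      = (T g)⁻¹ * ((T g * a⁻¹) * yAxisReflection) * a := by group
    _ = (T g)⁻¹ * (yAxisReflection * (T g * a⁻¹)) * a := by rw [hcomm]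
    _ = (T g)⁻¹ * yAxisReflection * T g := by group

theorem reflection_mul_self (ℓ : Set ℍ) : reflection ℓ * reflection ℓ = 1 := by
  have hJ : yAxisReflection * yAxisReflection = 1 := by
    ext z
    simp [coe_yAxisReflection_apply]
  unfold reflection
  split_ifs with h
  · generalize T h.choose = a
    calc a⁻¹ * yAxisReflection * a * (a⁻¹ * yAxisReflection * a)
        = a⁻¹ * (yAxisReflection * yAxisReflection) * a := by group
      _ = 1 := by rw [hJ]; group
  · simp

/-! ### Triangles and their reflection groups -/

/-- A geodesic triangle in `ℍ`, given by its three vertices, which do not lie on a common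
geodesic line. -/
structure Triangle where
  vertex : Fin 3 → ℍ
  not_collinear : ∀ ℓ : Set ℍ, IsGeodesicLine ℓ → ¬ ∀ i, vertex i ∈ ℓ

namespace Triangle

variable (𝒯 : Triangle)

/-- The geodesic line containing the side opposite to the `i`-th vertex (indices modulo `3`). -/
def sideLine (i : Fin 3) : Set ℍ := geodesicThrough (𝒯.vertex (i + 1)) (𝒯.vertex (i + 2))

/-- The interior angle at the `i`-th vertex. As the hyperbolic metric is conformal, this is the
Euclidean angle in `[0, π]` between the tangent vectors of the two sides that issue from it. -/
def angle (i : Fin 3) : ℝ :=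
  InnerProductGeometry.angle (tangentVector (𝒯.vertex i) (𝒯.vertex (i + 1)))
    (tangentVector (𝒯.vertex i) (𝒯.vertex (i + 2)))

/-- The reflection in the `i`-th side. -/
def R (i : Fin 3) : Equiv.Perm ℍ := reflection (𝒯.sideLine i)

/-- The group `Λ` generated by the reflections in the three sides. -/
def reflectionGroup : Subgroup (Equiv.Perm ℍ) := Subgroup.closure (Set.range 𝒯.R)

/-- The group `Λ₀` of all products of an even number of reflections in the sides. -/
def evenSubgroup : Subgroup (Equiv.Perm ℍ) where
  carrier := {x | ∃ l : List (Fin 3), Even l.length ∧ (l.map 𝒯.R).prod = x}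
  one_mem' := ⟨[], by simp⟩
  mul_mem' := by
    rintro _ _ ⟨l, hl, rfl⟩ ⟨l', hl', rfl⟩
    exact ⟨l ++ l', by simpa using! hl.add hl', by simp⟩
  inv_mem' := by
    rintro _ ⟨l, hl, rfl⟩
    refine ⟨l.reverse, by simpa using hl, ?_⟩
    have hR : (fun x => x⁻¹) ∘ 𝒯.R = 𝒯.R :=
      funext fun i => inv_eq_of_mul_eq_one_left (reflection_mul_self _)
    rw [List.prod_inv_reverse, List.map_map, hR, List.map_reverse]

/-- The triangle group `Γ = T⁻¹(Λ₀)` in `SL(2, ℝ)`. -/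
def Γ : Subgroup SL(2, ℝ) := 𝒯.evenSubgroup.comap T

end Triangle

/-! ### Lattices -/

section Lattice

variable {G : Type*} [Group G]

/-- `F` is a fundamental set for `Γ`: `G` is the disjoint union of the sets `γ F`, `γ ∈ Γ`. -/
def IsFundamentalSet (Γ : Subgroup G) (F : Set G) : Prop :=
  (⋃ γ : Γ, (fun x => (γ : G) * x) '' F) = Set.univ ∧
    Pairwise fun γ₁ γ₂ : Γ => Disjoint ((fun x => (γ₁ : G) * x) '' F) ((fun x => (γ₂ : G) * x) '' F)

/-- `Γ` is a lattice in `G`: it is discrete and `Γ \ G` has finite volume, the volume of `Γ \ G`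
being the Haar measure `m F` of a Borel fundamental set `F` (which does not depend on `F`). -/
def IsLattice [TopologicalSpace G] [MeasurableSpace G] (m : Measure G) (Γ : Subgroup G) : Prop :=
  DiscreteTopology Γ ∧ ∃ F : Set G, MeasurableSet F ∧ IsFundamentalSet Γ F ∧ m F < ⊤

/-- `Γ` is cocompact in `G`: the space `Γ \ G` of cosets `Γ g` is compact. -/
def IsCocompact [TopologicalSpace G] (Γ : Subgroup G) : Prop :=
  CompactSpace (Quotient (QuotientGroup.rightRel Γ))

end Lattice

end TriangleGroup

end

/-! Each side of the triangle is encoded by a normalised quadratic form (`Wall`), signed so that it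
is positive at the opposite vertex; its `height` is the hyperbolic sine of the signed distance to
the side. A reflection changes the height over another wall by a multiple of its own height, the
multiple being given by the Lorentzian `pairing` of the two walls. An interior angle `π / n` says
exactly that this pairing is `-cos (π / n)`.

Discreteness: the three heights therefore transform like the simple roots in the geometric
representation of the Coxeter group with exponents `n k`. Tits' argument
(`pos_of_not_isRightDescent`, `exists_neg_of_ne_one`) shows that a nontrivial element of the
reflection group carries an interior point across some side (`exists_height_neg`). An element of `Γ`
close to the identity keeps that point inside, so it acts trivially and equals `1`. No tessellation
of the plane is constructed.

Compactness: in the closure of an orbit, take a point nearest to an interior point `p` of the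
triangle. Were it on the negative side of a wall, reflecting it would bring it closer to `p`; so it
lies in the closed triangle, which is bounded. Neither the angles nor discreteness enter here. A
discrete group for which a compact set meets every orbit is a cocompact lattice.

Index two: reflections have determinant `-1`, so even words come from `SL(2, ℝ)`, whereas a single
reflection does not. -/

noncomputable section

namespace CoxeterSystem

/-! ### The sign of the geometric representation of a Coxeter group -/

variable {B W X : Type*} [Group W] {M : CoxeterMatrix B} (cs : CoxeterSystem M W) [MulAction W X]

/-- The orbit of a root under an alternating word lies in the plane of the two roots. -/
theorem sin_mul_alternatingWord {φ : B → X → ℝ}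
    (hφ : ∀ i j x, φ j (cs.simple i • x) = φ j x + 2 * Real.cos (Real.pi / M i j) * φ i x)
    (x : X) (k : ℕ) (i j : B) :
    Real.sin (Real.pi / M i j) * φ i ((cs.wordProd (alternatingWord i j k))⁻¹ • x) =
      Real.sin ((k + 1) * (Real.pi / M i j)) * φ (if Even k then i else j) x +
        Real.sin (k * (Real.pi / M i j)) * φ (if Even k then j else i) x := by
  have hself : ∀ i x, φ i (cs.simple i • x) = -φ i x := fun i x => by
    rw [hφ, M.diagonal]
    simp
    ring
  induction k using Nat.strong_induction_on generalizing i j with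
  | _ k ih =>
    match k with
    | 0 => simp [alternatingWord]
    | 1 =>
      have h2 : Real.sin ((1 + 1) * (Real.pi / M i j)) =
          2 * Real.sin (Real.pi / M i j) * Real.cos (Real.pi / M i j) := by
        rw [← Real.sin_two_mul]
        norm_num
      simp only [alternatingWord, List.concat_nil, wordProd_singleton, inv_simple, Nat.cast_one,
        Nat.not_even_one, if_false, one_mul, h2]
      rw [hφ, M.symmetric j i]
      ring
    | k + 2 =>
      -- Peeling off the last letter `j` and then `i` gives the recursion `sin ((m + 1) θ) = 2 cos θ
      -- sin (m θ) - sin ((m - 1) θ)` for both coefficients.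
      have h0 := ih k (by lia) i j
      have h1 := ih (k + 1) (by lia) j i
      rw [M.symmetric j i] at h1
      set θ := Real.pi / M i j with hθ
      set y := (cs.wordProd (alternatingWord j i (k + 1)))⁻¹ • x with hy
      have e1 : (cs.wordProd (alternatingWord i j (k + 2)))⁻¹ • x = cs.simple j • y := by
        rw [alternatingWord_succ, wordProd_concat, mul_inv_rev, inv_simple, mul_smul]
      have e2 : φ i y = -φ i ((cs.wordProd (alternatingWord i j k))⁻¹ • x) := by
        rw [hy, alternatingWord_succ, wordProd_concat, mul_inv_rev, inv_simple, mul_smul, hself]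
      have c1 : Real.sin (((k + 2 : ℕ) + 1) * θ) =
          2 * Real.cos θ * Real.sin (((k + 1 : ℕ) + 1) * θ) - Real.sin ((k + 1) * θ) := by
        have a1 : ((k + 2 : ℕ) + 1) * θ = ((k + 1 : ℕ) + 1) * θ + θ := by push_cast; ring
        have a2 : (k + 1) * θ = ((k + 1 : ℕ) + 1) * θ - θ := by push_cast; ring
        rw [a1, a2, Real.sin_add, Real.sin_sub]
        ring
      have c2 : Real.sin ((k + 2 : ℕ) * θ) =
          2 * Real.cos θ * Real.sin ((k + 1 : ℕ) * θ) - Real.sin (k * θ) := by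
        have a1 : (k + 2 : ℕ) * θ = (k + 1 : ℕ) * θ + θ := by push_cast; ring
        have a2 : k * θ = (k + 1 : ℕ) * θ - θ := by push_cast; ring
        rw [a1, a2, Real.sin_add, Real.sin_sub]
        ring
      rw [e1, hφ, M.symmetric j i, ← hθ, e2, c1, c2]
      rcases Nat.even_or_odd k with hk | hk
      · have hk1 : ¬ Even (k + 1) := by rw [Nat.even_add_one]; exact not_not.2 hk
        have hk2 : Even (k + 2) := by rw [Nat.even_add_one]; exact hk1
        rw [if_pos hk, if_pos hk] at h0
        rw [if_neg hk1, if_neg hk1] at h1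
        rw [if_pos hk2, if_pos hk2]
        linear_combination 2 * Real.cos θ * h1 - h0
      · have hk0 : ¬ Even k := Nat.not_even_iff_odd.2 hk
        have hk1 : Even (k + 1) := by rw [Nat.even_add_one]; exact hk0
        have hk2 : ¬ Even (k + 2) := by rw [Nat.even_add_one]; exact not_not.2 hk1
        rw [if_neg hk0, if_neg hk0] at h0
        rw [if_pos hk1, if_pos hk1] at h1
        rw [if_neg hk2, if_neg hk2]
        linear_combination 2 * Real.cos θ * h1 - h0

/-- If `i` is not a right descent of `w`, then `w` maps the `i`-th simple root to a positive
root. -/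
theorem pos_of_not_isRightDescent (hM : ∀ i j, M i j ≠ 0) {φ : B → X → ℝ}
    (hφ : ∀ i j x, φ j (cs.simple i • x) = φ j x + 2 * Real.cos (Real.pi / M i j) * φ i x)
    {p : X} (hp : ∀ i, 0 < φ i p) {w : W} {i : B} (hw : ¬ cs.IsRightDescent w i) :
    0 < φ i (w⁻¹ • p) := by
  induction hn : cs.length w using Nat.strong_induction_on generalizing w i with
  | _ n ih =>
    subst hn
    by_cases hw1 : w = 1
    · simpa [hw1] using hp i
    obtain ⟨j, hj⟩ := cs.exists_rightDescent_of_ne_one hw1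
    have hij : i ≠ j := fun h => hw (h ▸ hj)
    -- `P k`: a reduced factorisation of `w` whose right factor is alternating in `i`, `j`, of
    -- length `k` and ending in `j`. The longest such factor is stripped off, and induction applies
    -- to the shorter `v`.
    let P : ℕ → Prop := fun k =>
      ∃ v, w = v * cs.wordProd (alternatingWord i j k) ∧ cs.length v + k = cs.length w
    have hP1 : P 1 := by
      refine ⟨w * cs.simple j, by simp [alternatingWord], ?_⟩
      exact cs.isRightDescent_iff.1 hj
    have hdown : ∀ k, P (k + 1) → P k := by
      rintro k ⟨v, hv, hl⟩
      refine ⟨v * cs.simple (if Even k then j else i), ?_, ?_⟩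
      · rw [hv, alternatingWord_succ', wordProd_cons, mul_assoc]
      · have h1 := cs.length_mul_le v (cs.simple (if Even k then j else i))
        have h2 := cs.length_mul_le (v * cs.simple (if Even k then j else i))
          (cs.wordProd (alternatingWord i j k))
        have h3 := cs.length_wordProd_le (alternatingWord i j k)
        rw [length_alternatingWord] at h3
        rw [length_simple] at h1
        rw [mul_assoc, ← wordProd_cons, ← alternatingWord_succ', ← hv] at h2
        lia
    have hdown' : ∀ k l, P (k + l) → P k := by
      intro k l
      induction l with
      | zero => exact id
      | succ l ihl => exact fun h => ihl (hdown _ h)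
    -- By the braid relation an alternating word of full length `M i j` can also be written ending
    -- in `i`, which would make `i` a right descent.
    have hPm : ¬ P (M i j) := by
      rintro ⟨v, hv, hl⟩
      rw [show cs.wordProd (alternatingWord i j (M i j)) =
        cs.wordProd (alternatingWord j i (M j i)) from cs.wordProd_braidWord_eq i j,
        M.symmetric j i] at hv
      obtain ⟨m, hm⟩ := Nat.exists_eq_succ_of_ne_zero (hM i j)
      rw [hm, Nat.succ_eq_add_one, alternatingWord_succ, wordProd_concat, ← mul_assoc] at hv
      apply hw
      unfold IsRightDescent
      have h2 := cs.length_mul_le v (cs.wordProd (alternatingWord i j m))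
      have h3 := cs.length_wordProd_le (alternatingWord i j m)
      rw [length_alternatingWord] at h3
      have h4 : w * cs.simple i = v * cs.wordProd (alternatingWord i j m) := by
        rw [hv, simple_mul_simple_cancel_right]
      rw [h4]
      lia
    obtain ⟨k, hk0, hkm, ⟨v, hv, hl⟩, hmax⟩ :
        ∃ k, 1 ≤ k ∧ k < M i j ∧ P k ∧ ¬ P (k + 1) := by
      by_contra! hcon
      have hall : ∀ k, 1 ≤ k → k < M i j → P k := by
        intro k hk
        induction k, hk using Nat.le_induction with
        | base => exact fun _ => hP1
        | succ k hk ihk => exact fun h => hcon k hk (by lia) (ihk (by lia))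
      have h0 := hM i j
      have h1 := M.off_diagonal i j hij
      have h2 := hcon (M i j - 1) (by lia) (by lia) (hall _ (by lia) (by lia))
      rw [Nat.sub_add_cancel (by lia)] at h2
      exact hPm h2
    -- Otherwise this letter could move from `v` into the alternating factor, against the maximality
    -- of `k`.
    have ha : ¬ cs.IsRightDescent v (if Even k then j else i) := by
      intro h
      refine hmax ⟨v * cs.simple (if Even k then j else i), ?_, ?_⟩
      · rw [alternatingWord_succ', wordProd_cons, ← mul_assoc, simple_mul_simple_cancel_right, hv]
      · have := cs.isRightDescent_iff.1 h
        lia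
    -- This is the first letter of the alternating factor; if it were a descent of `v`, cancelling
    -- it would make `w` too short.
    have hb : ¬ cs.IsRightDescent v (if Even k then i else j) := by
      intro h
      have := cs.isRightDescent_iff.1 h
      obtain ⟨k', rfl⟩ := Nat.exists_eq_add_of_le' hk0
      have h' : (if Even (k' + 1) then i else j) = if Even k' then j else i := by
        simp only [Nat.even_add_one, ite_not]
      rw [h'] at this
      rw [alternatingWord_succ', wordProd_cons, ← mul_assoc] at hv
      have h2 := cs.length_mul_le (v * cs.simple (if Even k' then j else i))
        (cs.wordProd (alternatingWord i j k'))
      have h3 := cs.length_wordProd_le (alternatingWord i j k')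
      rw [length_alternatingWord] at h3
      rw [← hv] at h2
      lia
    have hpa := ih _ (by lia) ha rfl
    have hpb := ih _ (by lia) hb rfl
    have key := cs.sin_mul_alternatingWord hφ (v⁻¹ • p) k i j
    rw [← mul_smul, ← mul_inv_rev, ← hv] at key
    have hmpos : (0 : ℝ) < M i j := by exact_mod_cast Nat.pos_of_ne_zero (hM i j)
    have hπ := Real.pi_pos
    have hkm' : (k : ℝ) + 1 ≤ M i j := by exact_mod_cast hkm
    have hk0' : (1 : ℝ) ≤ k := by exact_mod_cast hk0
    have hθ : 0 < Real.pi / M i j := by positivity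
    have hmθ : M i j * (Real.pi / M i j) = Real.pi := by field_simp
    have s1 : 0 < Real.sin (Real.pi / M i j) :=
      Real.sin_pos_of_pos_of_lt_pi hθ (by nlinarith)
    have s2 : 0 < Real.sin (k * (Real.pi / M i j)) :=
      Real.sin_pos_of_pos_of_lt_pi (by positivity) (by nlinarith)
    -- This coefficient vanishes when `k + 1 = M i j`; strict positivity comes from `s2`.
    have s3 : 0 ≤ Real.sin ((k + 1) * (Real.pi / M i j)) :=
      Real.sin_nonneg_of_nonneg_of_le_pi (by positivity) (by nlinarith)
    have : 0 < Real.sin (Real.pi / M i j) * φ i (w⁻¹ • p) := by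
      rw [key]
      have := mul_nonneg s3 hpb.le
      have := mul_pos s2 hpa
      linarith
    exact (mul_pos_iff_of_pos_left s1).1 this

/-- A nontrivial element of a Coxeter group moves the open fundamental chamber off itself. -/
theorem exists_neg_of_ne_one (hM : ∀ i j, M i j ≠ 0) {φ : B → X → ℝ}
    (hφ : ∀ i j x, φ j (cs.simple i • x) = φ j x + 2 * Real.cos (Real.pi / M i j) * φ i x)
    {p : X} (hp : ∀ i, 0 < φ i p) {w : W} (hw : w ≠ 1) : ∃ i, φ i (w • p) < 0 := by
  obtain ⟨i, hi⟩ := cs.exists_leftDescent_of_ne_one hw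
  refine ⟨i, ?_⟩
  have h1 : ¬ cs.IsRightDescent (cs.simple i * w)⁻¹ i := by
    rw [isRightDescent_inv_iff]
    exact cs.isLeftDescent_iff_not_isLeftDescent_mul.1 hi
  have h2 := cs.pos_of_not_isRightDescent hM hφ hp h1
  rw [inv_inv, mul_smul, hφ, M.diagonal] at h2
  simp at h2
  linarith

end CoxeterSystem

namespace TriangleGroup

/-! ### Lattices from compact sets -/

section Lattice

open scoped Pointwise Topology

variable {G : Type*} [Group G] [TopologicalSpace G] {Γ : Subgroup G} {K : Set G}

theorem isCocompact_of_isCompact (hK : IsCompact K) (hcov : ∀ g : G, ∃ γ ∈ Γ, γ * g ∈ K) :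
    IsCocompact Γ := by
  have hcont : Continuous (Quotient.mk (QuotientGroup.rightRel Γ)) := continuous_quotient_mk'
  refine ⟨?_⟩
  convert hK.image hcont
  symm
  rw [Set.eq_univ_iff_forall]
  intro q
  induction q using Quotient.inductionOn with
  | _ g =>
    obtain ⟨γ, hγ, hg⟩ := hcov g
    refine ⟨γ * g, hg, Quotient.sound ?_⟩
    refine QuotientGroup.rightRel_apply.2 ?_
    simpa using hγ

variable [IsTopologicalGroup G]

/-- Near every point there is an open set of finite measure whose translates by a discrete
subgroup are disjoint. -/
theorem exists_isOpen_mul_inv_mem [MeasurableSpace G] (m : Measure G) [IsLocallyFiniteMeasure m]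
    [DiscreteTopology Γ] (x : G) :
    ∃ U : Set G, IsOpen U ∧ x ∈ U ∧ m U < ⊤ ∧ ∀ a ∈ U, ∀ b ∈ U, a * b⁻¹ ∈ Γ → a = b := by
  obtain ⟨V, hV, hV1⟩ := isOpen_induced_iff.1 (isOpen_discrete ({1} : Set Γ))
  have h1V : (1 : G) ∈ V := by
    have : (1 : Γ) ∈ Subtype.val ⁻¹' V := hV1 ▸ Set.mem_singleton 1
    simpa using! this
  -- `V` meets `Γ` only in `1`, so it suffices that all quotients `a * b⁻¹` of points near `x` lie
  -- in `V`.
  have hcont : Continuous fun q : G × G => q.1 * q.2⁻¹ := by fun_prop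
  have hmem : (fun q : G × G => q.1 * q.2⁻¹) ⁻¹' V ∈ 𝓝 (x, x) :=
    (hV.preimage hcont).mem_nhds (by simpa using! h1V)
  rw [nhds_prod_eq, Filter.mem_prod_same_iff] at hmem
  obtain ⟨A, hA, hAV⟩ := hmem
  obtain ⟨E, hE, hmE⟩ := m.finiteAt_nhds x
  obtain ⟨U, hU, hUo, hxU⟩ := mem_nhds_iff.1 (Filter.inter_mem hA hE)
  refine ⟨U, hUo, hxU, (measure_mono fun y hy => (hU hy).2).trans_lt hmE,
    fun a ha b hb hab => ?_⟩
  have h2 : a * b⁻¹ ∈ V := hAV (Set.mk_mem_prod (hU ha).1 (hU hb).1)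
  have h3 : (⟨a * b⁻¹, hab⟩ : Γ) ∈ ({1} : Set Γ) := hV1 ▸ h2
  exact mul_inv_eq_one.1 (congrArg Subtype.val (Set.mem_singleton_iff.1 h3))

/-- Finitely many small open sets `O k` cover `K`. Each orbit is represented in the first `O k` that
it meets; removing from `O k` the saturations `S l` of the earlier sets leaves exactly one
representative, and the resulting set is Borel. -/
theorem isLattice_of_isCompact [MeasurableSpace G] [BorelSpace G] (m : Measure G)
    [IsLocallyFiniteMeasure m] [DiscreteTopology Γ] (hK : IsCompact K)
    (hcov : ∀ g : G, ∃ γ ∈ Γ, γ * g ∈ K) : IsLattice m Γ := by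
  refine ⟨inferInstance, ?_⟩
  choose U hUo hxU hUm hUΓ using fun x : G => exists_isOpen_mul_inv_mem (Γ := Γ) m x
  obtain ⟨t, ht⟩ := hK.elim_finite_subcover U hUo fun x _ => Set.mem_iUnion.2 ⟨x, hxU x⟩
  let N := t.toList.length
  let O : Fin N → Set G := fun k => U (t.toList.get k)
  have hOo : ∀ k, IsOpen (O k) := fun k => hUo _
  let S : Fin N → Set G := fun k => {g | ∃ γ ∈ Γ, γ * g ∈ O k}
  have hS : ∀ k, IsOpen (S k) := fun k => by
    have : S k = ⋃ γ ∈ Γ, (fun g => γ * g) ⁻¹' O k := by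
      ext g
      simp [S]
    rw [this]
    exact isOpen_biUnion fun γ _ => (hOo k).preimage (continuous_const_mul γ)
  let F : Set G := ⋃ k, O k \ ⋃ l, ⋃ (_ : l < k), S l
  have hSinv : ∀ k, ∀ γ ∈ Γ, ∀ g, γ * g ∈ S k → g ∈ S k := by
    rintro k γ hγ g ⟨δ, hδ, hg⟩
    exact ⟨δ * γ, Γ.mul_mem hδ hγ, by rwa [mul_assoc]⟩
  have hOS : ∀ k, O k ⊆ S k := fun k g hg => ⟨1, Γ.one_mem, by simpa using hg⟩
  have huniq : ∀ a ∈ F, ∀ b ∈ F, a * b⁻¹ ∈ Γ → a = b := by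
    have hle : ∀ k l a b, a ∈ O k → b ∈ O l \ ⋃ i, ⋃ (_ : i < l), S i → a * b⁻¹ ∈ Γ → l ≤ k := by
      intro k l a b ha hb hab
      by_contra hlt
      refine hb.2 (Set.mem_iUnion₂.2 ⟨k, not_le.1 hlt, hSinv k _ hab b ?_⟩)
      simpa using hOS k ha
    intro a ha b hb hab
    obtain ⟨k, hk⟩ := Set.mem_iUnion.1 ha
    obtain ⟨l, hl⟩ := Set.mem_iUnion.1 hb
    have hba : b * a⁻¹ ∈ Γ := by simpa using Γ.inv_mem hab
    obtain rfl : k = l := le_antisymm (hle l k b a hl.1 hk hba) (hle k l a b hk.1 hl hab)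
    exact hUΓ _ a hk.1 b hl.1 hab
  refine ⟨F, ?_, ⟨?_, ?_⟩, ?_⟩
  · exact MeasurableSet.iUnion fun k => (hOo k).measurableSet.diff
      (MeasurableSet.iUnion fun l => MeasurableSet.iUnion fun _ => (hS l).measurableSet)
  · rw [Set.eq_univ_iff_forall]
    intro g
    have hex : ∃ k, g ∈ S k := by
      obtain ⟨γ, hγ, hg⟩ := hcov g
      obtain ⟨x, hx, hgx⟩ := Set.mem_iUnion₂.1 (ht hg)
      obtain ⟨k, hk⟩ := List.get_of_mem (Finset.mem_toList.2 hx)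
      exact ⟨k, γ, hγ, by simpa only [O, hk] using hgx⟩
    obtain ⟨k, ⟨γ, hγ, hg⟩, hmin⟩ := WellFounded.has_min wellFounded_lt {k | g ∈ S k} hex
    refine Set.mem_iUnion.2 ⟨⟨γ⁻¹, Γ.inv_mem hγ⟩, γ * g, Set.mem_iUnion.2 ⟨k, hg, ?_⟩, by simp⟩
    intro h
    obtain ⟨l, hlk, hl⟩ := Set.mem_iUnion₂.1 h
    exact hmin l (hSinv l γ hγ g hl) hlk
  · rintro ⟨γ₁, h₁⟩ ⟨γ₂, h₂⟩ hne
    refine Set.disjoint_left.2 ?_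
    rintro _ ⟨a, ha, rfl⟩ ⟨b, hb, hab⟩
    have hab' : γ₂ * b = γ₁ * a := hab
    have h3 : a * b⁻¹ = γ₁⁻¹ * γ₂ := by
      rw [mul_inv_eq_iff_eq_mul, mul_assoc, hab', inv_mul_cancel_left]
    obtain rfl := huniq a ha b hb (h3 ▸ Γ.mul_mem (Γ.inv_mem h₁) h₂)
    exact hne (Subtype.ext (mul_right_cancel hab').symm)
  · refine (measure_iUnion_le _).trans_lt ?_
    rw [tsum_fintype]
    exact ENNReal.sum_lt_top.2 fun k _ => (measure_mono Set.sdiff_subset).trans_lt (hUm _)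

end Lattice

/-! ### Walls: oriented geodesic lines -/

/-- An oriented geodesic line, given by the normalised real quadratic form
`a |z|² + b Re z + c` that vanishes on it. -/
structure Wall where
  a : ℝ
  b : ℝ
  c : ℝ
  disc : b ^ 2 - 4 * a * c = 1

namespace Wall

variable (w w' : Wall)

/-- The hyperbolic sine of the signed distance to the line. -/
def height (z : ℍ) : ℝ := (w.a * (z.re ^ 2 + z.im ^ 2) + w.b * z.re + w.c) / z.im

/-- The Lorentzian inner product of the unit normals. -/
def pairing : ℝ := w.b * w'.b - 2 * w.a * w'.c - 2 * w.c * w'.a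

/-- The same line with the opposite orientation. -/
protected def neg : Wall := ⟨-w.a, -w.b, -w.c, by have := w.disc; linarith⟩

/-- The matrix of determinant `-1` that acts on `ℍ` as the reflection in the line. -/
def toGL : GL (Fin 2) ℝ :=
  .mkOfDetNeZero !![-w.b, -2 * w.c; 2 * w.a, w.b] (by
    have := w.disc
    rw [Matrix.det_fin_two_of]
    intro h
    linarith)

theorem coe_toGL : (w.toGL : Matrix (Fin 2) (Fin 2) ℝ) = !![-w.b, -2 * w.c; 2 * w.a, w.b] := rfl

theorem det_toGL : w.toGL.det = -1 := by
  ext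
  have := w.disc
  rw [Matrix.GeneralLinearGroup.val_det_apply, coe_toGL, Matrix.det_fin_two_of]
  push_cast
  linarith

/-- The reflection in the line. -/
def refl : Equiv.Perm ℍ := MulAction.toPermHom (GL (Fin 2) ℝ) ℍ w.toGL

theorem refl_apply (z : ℍ) : w.refl z = w.toGL • z := rfl

theorem refl_neg : w.neg.refl = w.refl := by
  have : w.neg.toGL = -w.toGL := by
    ext i j
    fin_cases i <;> fin_cases j <;> simp [toGL, Wall.neg]
  ext1 z
  rw [refl_apply, refl_apply, this, UpperHalfPlane.neg_smul]

theorem height_neg (z : ℍ) : w.neg.height z = -w.height z := by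
  simp only [height, Wall.neg]
  ring

/-- The squared norm of the denominator of the reflection. -/
def denomSq (z : ℍ) : ℝ := (2 * w.a * z.re + w.b) ^ 2 + (2 * w.a * z.im) ^ 2

theorem normSq_denom (z : ℍ) : Complex.normSq (denom w.toGL z) = w.denomSq z := by
  simp [denom, coe_toGL, Complex.normSq_apply, denomSq]
  ring

theorem denomSq_pos (z : ℍ) : 0 < w.denomSq z := by
  rw [← normSq_denom]
  exact normSq_denom_pos _ z.im_ne_zero

theorem re_refl (z : ℍ) : (w.refl z).re =
    -((w.b * z.re + 2 * w.c) * (2 * w.a * z.re + w.b) + 2 * w.a * w.b * z.im ^ 2) /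
      w.denomSq z := by
  rw [refl_apply, re_smul, Complex.div_re, normSq_denom, ← add_div]
  simp [num, denom, coe_toGL]
  ring

theorem im_refl (z : ℍ) : (w.refl z).im = z.im / w.denomSq z := by
  rw [refl_apply, im_smul_eq_div_normSq, normSq_denom, det_toGL]
  simp

/-- The action of a reflection on the functions `(a |z|² + b Re z + c) / Im z`. -/
theorem quadratic_refl (a b c : ℝ) (z : ℍ) :
    (a * ((w.refl z).re ^ 2 + (w.refl z).im ^ 2) + b * (w.refl z).re + c) / (w.refl z).im =
      (a * (z.re ^ 2 + z.im ^ 2) + b * z.re + c) / z.im -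
        2 * (w.b * b - 2 * w.a * c - 2 * w.c * a) * w.height z := by
  have hD := w.denomSq_pos z
  have hy := z.im_pos
  have hdisc := w.disc
  set E := (w.b * z.re + 2 * w.c) ^ 2 + (w.b * z.im) ^ 2 with hE
  have hnorm : (w.refl z).re ^ 2 + (w.refl z).im ^ 2 = E / w.denomSq z := by
    rw [re_refl, im_refl, div_pow, div_pow, ← add_div,
      div_eq_div_iff (by positivity) (by positivity), hE, denomSq]
    have h2 : (w.b ^ 2 - 4 * w.a * w.c) ^ 2 = 1 := by rw [hdisc]; ring
    linear_combination (-(z.im ^ 2) * ((2 * w.a * z.re + w.b) ^ 2 + (2 * w.a * z.im) ^ 2)) * h2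
  rw [hnorm, im_refl, re_refl, hE, height]
  field_simp
  unfold denomSq
  linear_combination (a * (z.re ^ 2 + z.im ^ 2) + b * z.re + c) * hdisc

/-- With pairing `-cos (π / m)` this is the transformation law required of `φ` in the Coxeter-group
lemmas. -/
theorem height_refl (z : ℍ) :
    w'.height (w.refl z) = w'.height z - 2 * w.pairing w' * w.height z :=
  w.quadratic_refl w'.a w'.b w'.c z

theorem refl_mul_self : w.refl * w.refl = 1 := by
  have hS : w.toGL * w.toGL = 1 := by
    ext i j
    have := w.disc
    fin_cases i <;> fin_cases j <;> simp [coe_toGL, Matrix.mul_apply, Fin.sum_univ_two] <;>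
      linarith
  unfold refl
  rw [← map_mul, hS, map_one]

/-- The form is the numerator of `Re (T g z)`, for `g` moving the line to the `y`-axis; its
discriminant is `(det g) ^ 2 = 1`. -/
theorem exists_wall {ℓ : Set ℍ} (hℓ : IsGeodesicLine ℓ) :
    ∃ w : Wall, reflection ℓ = w.refl ∧ ∀ z, z ∈ ℓ ↔ w.height z = 0 := by
  obtain ⟨g, hg⟩ := exists_image_eq_yAxis hℓ
  have hdet : g 0 0 * g 1 1 - g 0 1 * g 1 0 = 1 := by
    have := g.det_coe
    rwa [Matrix.det_fin_two] at this
  refine ⟨⟨g 0 0 * g 1 0, g 0 0 * g 1 1 + g 0 1 * g 1 0, g 0 1 * g 1 1, ?_⟩, ?_, fun z => ?_⟩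
  · linear_combination (g 0 0 * g 1 1 - g 0 1 * g 1 0 + 1) * hdet
  · rw [reflection_eq hg]
    set w : Wall := ⟨g 0 0 * g 1 0, g 0 0 * g 1 1 + g 0 1 * g 1 0, g 0 1 * g 1 1, _⟩ with hw
    have hmul : (g : GL (Fin 2) ℝ) * w.toGL = J * (g : GL (Fin 2) ℝ) := by
      ext i j
      fin_cases i <;> fin_cases j <;>
        simp [coe_toGL, Matrix.mul_apply, Fin.sum_univ_two, hw, J]
      · linear_combination (-g 0 0) * hdet
      · linear_combination (-g 0 1) * hdet
      · linear_combination (g 1 0) * hdet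
      · linear_combination (g 1 1) * hdet
    rw [mul_assoc, inv_mul_eq_iff_eq_mul]
    ext1 z
    change J • ((g : GL (Fin 2) ℝ) • z) = (g : GL (Fin 2) ℝ) • (w.toGL • z)
    rw [← mul_smul, ← mul_smul, hmul]
  · have h1 : z ∈ ℓ ↔ (T g z).re = 0 := by
      rw [show (T g z).re = 0 ↔ T g z ∈ yAxis from Iff.rfl, ← hg,
        (T g).injective.mem_set_image]
    rw [h1, ← UpperHalfPlane.coe_re, coe_T_apply, Complex.div_re, ← add_div, div_eq_zero_iff]
    have hden : Complex.normSq (((g 1 0 : ℝ) : ℂ) * (z : ℂ) + ((g 1 1 : ℝ) : ℂ)) ≠ 0 := by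
      have := UpperHalfPlane.denom_ne_zero (g : GL (Fin 2) ℝ) z
      simpa [UpperHalfPlane.denom] using! this
    rw [or_iff_left hden, height, div_eq_zero_iff, or_iff_left z.im_ne_zero]
    simp
    constructor <;> intro h <;> linarith

/-- The order of the product of two reflections in lines meeting at the angle `π / n`. -/
theorem refl_mul_refl_pow {n : ℕ} (hn : 2 ≤ n) (h : w.pairing w' = -Real.cos (Real.pi / n)) :
    (w.refl * w'.refl) ^ n = 1 := by
  set θ := Real.pi / n with hθ
  have hn0 : (0 : ℝ) < n := by positivity
  have hs : 0 < Real.sin θ := by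
    refine Real.sin_pos_of_pos_of_lt_pi (by positivity) ?_
    have : (2 : ℝ) ≤ n := by exact_mod_cast hn
    rw [hθ, div_lt_iff₀ hn0]
    nlinarith [Real.pi_pos]
  -- The sign makes the trace `2 cos θ`, with determinant `1`. So `N` behaves like a rotation by
  -- `θ`, and Cayley–Hamilton yields `N ^ n = -1`, which acts trivially on `ℍ`.
  let N : Matrix (Fin 2) (Fin 2) ℝ := -(w.toGL.1 * w'.toGL.1)
  have hN : N * N = (2 * Real.cos θ) • N - 1 := by
    have hCH : N * N = N.trace • N - N.det • 1 := by
      rw [Matrix.trace_fin_two, Matrix.det_fin_two]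
      ext i j
      fin_cases i <;> fin_cases j <;> simp [Matrix.mul_apply, Fin.sum_univ_two] <;> ring
    have htr : N.trace = 2 * Real.cos θ := by
      rw [show Real.cos θ = -w.pairing w' by rw [h]; ring]
      simp [N, coe_toGL, Matrix.trace_fin_two, pairing]
      ring
    have hdet : N.det = 1 := by
      have d := w.disc
      have d' := w'.disc
      rw [Matrix.det_neg, Matrix.det_mul, coe_toGL, coe_toGL, Matrix.det_fin_two_of,
        Matrix.det_fin_two_of]
      simp
      linear_combination d + d' + (w.b ^ 2 - 4 * w.a * w.c - 1) * d'
    rw [hCH, htr, hdet, one_smul]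
  have hpow : ∀ k : ℕ, Real.sin θ • N ^ (k + 1) =
      Real.sin ((k + 1) * θ) • N - Real.sin (k * θ) • (1 : Matrix (Fin 2) (Fin 2) ℝ) := by
    intro k
    induction k with
    | zero => simp
    | succ k ih =>
      have a1 : Real.sin (((k + 1 : ℕ) + 1) * θ) =
          2 * Real.cos θ * Real.sin ((k + 1) * θ) - Real.sin (k * θ) := by
        have e1 : ((k + 1 : ℕ) + 1) * θ = (k + 1) * θ + θ := by push_cast; ring
        have e2 : k * θ = (k + 1) * θ - θ := by ring
        rw [e1, e2, Real.sin_add, Real.sin_sub]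
        ring
      rw [pow_succ, ← smul_mul_assoc, ih, sub_mul, smul_mul_assoc, hN, a1]
      push_cast
      rw [smul_mul_assoc, one_mul]
      module
  have hNn : N ^ n = -1 := by
    obtain ⟨k, rfl⟩ := Nat.exists_eq_add_of_le' (show 1 ≤ n by lia)
    have h1 := hpow k
    have e1 : ((k : ℝ) + 1) * θ = Real.pi := by
      rw [hθ]; push_cast at hn0 ⊢; field_simp
    have e2 : (k : ℝ) * θ = Real.pi - θ := by rw [← e1]; ring
    rw [e1, e2, Real.sin_pi, Real.sin_pi_sub, zero_smul, zero_sub, ← smul_neg] at h1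
    exact smul_right_injective _ hs.ne' h1
  have hGL : (w.toGL * w'.toGL) ^ n = -((-1) ^ n) := by
    ext1
    have : (w.toGL.1 * w'.toGL.1) = -1 * N := by simp [N]
    push_cast
    rw [this, Commute.mul_pow (Commute.neg_one_left N), hNn]
    simp
  unfold refl
  rw [← map_mul, ← map_pow, hGL]
  ext1 z
  change (-((-1) ^ n) : GL (Fin 2) ℝ) • z = z
  rw [UpperHalfPlane.neg_smul]
  rcases neg_one_pow_eq_or (GL (Fin 2) ℝ) n with h | h <;> rw [h] <;> simp

end Wall

/-! ### Angles -/

/-- A positive multiple of the tangent vector at `p` of the geodesic segment from `p` to `q`, given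
by a formula that is uniform in `p` and `q`. -/
def direction (p q : ℍ) : ℂ :=
  ⟨(q.re - p.re) * p.im, ((q.re - p.re) ^ 2 + q.im ^ 2 - p.im ^ 2) / 2⟩

theorem exists_tangentVector_eq (p q : ℍ) :
    ∃ r : ℝ, 0 < r ∧ tangentVector p q = r • direction p q := by
  have hp := p.im_pos
  have hq := q.im_pos
  unfold tangentVector direction
  split_ifs with h
  · obtain ⟨r, hr, hr2⟩ : ∃ r : ℝ, 0 < r ∧ r * (p.im + q.im) = 2 :=
      ⟨2 / (p.im + q.im), by positivity, by field_simp⟩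
    refine ⟨r, hr, ?_⟩
    apply Complex.ext
    · simp [h]
    · simp [h]
      linear_combination (p.im - q.im) / 2 * hr2
  · have h' : q.re - p.re ≠ 0 := sub_ne_zero.mpr (Ne.symm h)
    refine ⟨1, one_pos, ?_⟩
    have hc : center p q * (2 * (q.re - p.re)) = ‖(q : ℂ)‖ ^ 2 - ‖(p : ℂ)‖ ^ 2 := by
      unfold center
      field_simp
    simp only [← Complex.normSq_eq_norm_sq, Complex.normSq_apply, UpperHalfPlane.coe_re,
      UpperHalfPlane.coe_im] at hc
    apply Complex.ext
    · simp
      ring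
    · simp
      linear_combination hc / 2

namespace Wall

variable (w w' : Wall)

/-- The unit normal vector at a point of the line, up to the factor `p.im`. -/
def normal (p : ℍ) : ℂ := ⟨2 * w.a * p.re + w.b, 2 * w.a * p.im⟩

theorem height_eq_zero_iff (p : ℍ) :
    w.height p = 0 ↔ w.a * (p.re ^ 2 + p.im ^ 2) + w.b * p.re + w.c = 0 := by
  rw [height, div_eq_zero_iff, or_iff_left p.im_ne_zero]

variable {w w'}

/-- Turns the side of the line on which `q` lies into the sign of a Euclidean inner product at `p`.
-/
theorem inner_normal_direction {p : ℍ} (hp : w.height p = 0) (q : ℍ) :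
    (w.normal p).re * (direction p q).re + (w.normal p).im * (direction p q).im =
      p.im * q.im * w.height q := by
  have hq : q.im * w.height q = w.a * (q.re ^ 2 + q.im ^ 2) + w.b * q.re + w.c := by
    unfold height
    field_simp [q.im_ne_zero]
  rw [height_eq_zero_iff] at hp
  rw [mul_assoc, hq]
  simp only [normal, direction]
  linear_combination (-p.im) * hp

theorem inner_normal_normal {p : ℍ} (hp : w.height p = 0) (hp' : w'.height p = 0) :
    (w.normal p).re * (w'.normal p).re + (w.normal p).im * (w'.normal p).im = w.pairing w' := by
  rw [height_eq_zero_iff] at hp hp'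
  simp only [normal, pairing]
  linear_combination 2 * w'.a * hp + 2 * w.a * hp'

theorem pairing_self : w.pairing w = 1 := by
  have := w.disc
  unfold pairing
  linarith

/-- If `p`, `q` lie on `w` and `p`, `q'` lie on `w'`, and `q'`, `q` are on the positive sides of
`w`, `w'`, then the normals of `w` and `w'` enclose the supplement of the angle at `p`. -/
theorem pairing_eq_neg_cos_angle {p q q' : ℍ} (hp : w.height p = 0) (hp' : w'.height p = 0)
    (hq : w.height q = 0) (hq' : w'.height q' = 0) (hpos : 0 < w.height q')
    (hpos' : 0 < w'.height q) :
    w.pairing w' =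
      -Real.cos (InnerProductGeometry.angle (tangentVector p q) (tangentVector p q')) := by
  obtain ⟨r, hr, e⟩ := exists_tangentVector_eq p q
  obtain ⟨r', hr', e'⟩ := exists_tangentVector_eq p q'
  rw [e, e', InnerProductGeometry.angle_smul_left_of_pos _ _ hr,
    InnerProductGeometry.angle_smul_right_of_pos _ _ hr', InnerProductGeometry.cos_angle]
  have n1 := inner_normal_normal hp hp
  have n2 := inner_normal_normal hp' hp'
  have n3 := inner_normal_normal hp hp'
  rw [pairing_self] at n1 n2
  have i1 := inner_normal_direction hp q
  have i2 := inner_normal_direction hp q'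
  have i3 := inner_normal_direction hp' q
  have i4 := inner_normal_direction hp' q'
  rw [hq, mul_zero] at i1
  rw [hq', mul_zero] at i4
  have k2 : 0 < p.im * q'.im * w.height q' := by have := p.im_pos; have := q'.im_pos; positivity
  have k3 : 0 < p.im * q.im * w'.height q := by have := p.im_pos; have := q.im_pos; positivity
  rw [← i2] at k2
  rw [← i3] at k3
  rw [← n3]
  generalize w.normal p = n at *
  generalize w'.normal p = n' at *
  generalize direction p q = t at *
  generalize direction p q' = t' at *
  -- Since `t` is orthogonal to the unit vector `n`, it is `l` times `n` turned by a right angle;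
  -- likewise `t'` with `l'` and `n'`. The side conditions force `l * l' < 0`, whence the minus sign
  -- in front of the cosine.
  set l := n.re * t.im - n.im * t.re with hl
  set l' := n'.re * t'.im - n'.im * t'.re with hl'
  have t1 : t.re = -(l * n.im) := by
    rw [hl]; linear_combination n.re * i1 - t.re * n1
  have t2 : t.im = l * n.re := by
    rw [hl]; linear_combination n.im * i1 - t.im * n1
  have t3 : t'.re = -(l' * n'.im) := by
    rw [hl']; linear_combination n'.re * i4 - t'.re * n2
  have t4 : t'.im = l' * n'.re := by
    rw [hl']; linear_combination n'.im * i4 - t'.im * n2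
  have ht : ‖t‖ = |l| := by
    rw [← sq_eq_sq₀ (norm_nonneg _) (abs_nonneg _), sq_abs, ← Complex.normSq_eq_norm_sq,
      Complex.normSq_apply, t1, t2]
    linear_combination l ^ 2 * n1
  have ht' : ‖t'‖ = |l'| := by
    rw [← sq_eq_sq₀ (norm_nonneg _) (abs_nonneg _), sq_abs, ← Complex.normSq_eq_norm_sq,
      Complex.normSq_apply, t3, t4]
    linear_combination l' ^ 2 * n2
  have hneg : l * l' < 0 := by
    have hprod := mul_pos k2 k3
    rw [t1, t2, t3, t4] at hprod
    have e3 : (n.re * -(l' * n'.im) + n.im * (l' * n'.re)) *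
        (n'.re * -(l * n.im) + n'.im * (l * n.re)) =
        -(l * l') * (n.re * n'.im - n.im * n'.re) ^ 2 := by ring
    rw [e3] at hprod
    by_contra hcon
    nlinarith [sq_nonneg (n.re * n'.im - n.im * n'.re)]
  rw [ht, ht', ← abs_mul, abs_of_neg hneg, Complex.inner, div_neg, neg_neg, eq_div_iff hneg.ne,
    Complex.mul_re, Complex.conj_re, Complex.conj_im, t1, t2, t3, t4]
  ring

end Wall

/-! ### Hyperboloid coordinates and the closed triangle -/

/-- The coordinates of a point of `ℍ` in the hyperboloid model. -/
def hyperboloid (z : ℍ) : Fin 3 → ℝ := ![(z.re ^ 2 + z.im ^ 2) / z.im, z.re / z.im, 1 / z.im]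

theorem Wall.height_eq_hyperboloid (w : Wall) (z : ℍ) :
    w.height z = w.a * hyperboloid z 0 + w.b * hyperboloid z 1 + w.c * hyperboloid z 2 := by
  simp [hyperboloid, Wall.height]
  ring

theorem cosh_dist_eq_hyperboloid (z z' : ℍ) : Real.cosh (dist z z') =
    (hyperboloid z 0 * hyperboloid z' 2 + hyperboloid z 2 * hyperboloid z' 0) / 2 -
      hyperboloid z 1 * hyperboloid z' 1 := by
  have := z.im_pos
  have := z'.im_pos
  rw [UpperHalfPlane.cosh_dist, Complex.dist_eq, ← Complex.normSq_eq_norm_sq, Complex.normSq_apply]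
  simp [hyperboloid]
  field_simp
  ring

/-- For fixed `p`, `cosh (dist p z)` is itself a quadratic form in `z` divided by `Im z`, now of
discriminant `-1`, so `quadratic_refl` applies. If `p` and `z` are strictly on opposite sides,
reflecting `z` brings it closer to `p`. -/
theorem cosh_dist_refl (w : Wall) (p z : ℍ) :
    Real.cosh (dist p (w.refl z)) = Real.cosh (dist p z) + 2 * w.height p * w.height z := by
  have h : ∀ q : ℍ, Real.cosh (dist p q) =
      (1 / (2 * p.im) * (q.re ^ 2 + q.im ^ 2) + -p.re / p.im * q.re +
        (p.re ^ 2 + p.im ^ 2) / (2 * p.im)) / q.im := fun q => by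
    rw [cosh_dist_eq_hyperboloid]
    simp [hyperboloid]
    ring
  rw [h, h, Wall.quadratic_refl]
  unfold Wall.height
  field_simp [p.im_ne_zero, z.im_ne_zero]
  ring

section

variable {w : Fin 3 → Wall} {v : Fin 3 → ℍ}
  (hzero : ∀ i j, i ≠ j → (w i).height (v j) = 0) (hpos : ∀ i, 0 < (w i).height (v i))

include hzero hpos

/-- The hyperboloid coordinates of a point are determined by its heights. -/
theorem hyperboloid_eq_sum (z : ℍ) (j : Fin 3) :
    hyperboloid z j =
      ∑ k, (w k).height z / (w k).height (v k) * hyperboloid (v k) j := by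
  let F : Matrix (Fin 3) (Fin 3) ℝ := Matrix.of fun i => ![(w i).a, (w i).b, (w i).c]
  -- The vertices, divided by their own heights, are the basis dual to the three wall forms.
  let V : Matrix (Fin 3) (Fin 3) ℝ :=
    Matrix.of fun j k => hyperboloid (v k) j / (w k).height (v k)
  have hF : ∀ z i, (F.mulVec (hyperboloid z)) i = (w i).height z := fun z i => by
    rw [Wall.height_eq_hyperboloid]
    simp [F, Matrix.mulVec, dotProduct, Fin.sum_univ_three]
  have hFV : F * V = 1 := by
    ext i k
    have h1 : (F * V) i k = (F.mulVec (hyperboloid (v k))) i / (w k).height (v k) := by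
      simp [Matrix.mul_apply, Matrix.mulVec, dotProduct, Fin.sum_univ_three, V]
      ring
    rw [h1, hF]
    by_cases h : i = k
    · subst h
      rw [div_self (hpos i).ne', Matrix.one_apply_eq]
    · rw [hzero i k h, zero_div, Matrix.one_apply_ne h]
  have hVF := mul_eq_one_comm.1 hFV
  have h2 : V.mulVec (F.mulVec (hyperboloid z)) = hyperboloid z := by
    rw [Matrix.mulVec_mulVec, hVF, Matrix.one_mulVec]
  rw [← congrFun h2 j]
  simp only [Matrix.mulVec, dotProduct, V, Matrix.of_apply]
  refine Finset.sum_congr rfl fun k _ => ?_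
  rw [← hF z k, Matrix.mulVec, dotProduct]
  ring

/-- The open triangle is nonempty. -/
theorem exists_forall_height_pos : ∃ p : ℍ, ∀ i, 0 < (w i).height p := by
  -- `(A, B, C)` is the sum of the vertices in Lorentz space. It is timelike, and the witness is its
  -- radial projection to the hyperboloid, which does not change the signs of the wall forms.
  set A := ∑ k, hyperboloid (v k) 0 with hA
  set B := ∑ k, hyperboloid (v k) 1 with hB
  set C := ∑ k, hyperboloid (v k) 2 with hC
  have hC0 : 0 < C := Finset.sum_pos (fun k _ => by
    have := (v k).im_pos
    simp [hyperboloid]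
    positivity) ⟨0, Finset.mem_univ _⟩
  have hAC : 0 < A * C - B ^ 2 := by
    have h1 := fun i j => cosh_dist_eq_hyperboloid (v i) (v j)
    have h2 := fun i j => Real.cosh_pos (dist (v i) (v j))
    have : A * C - B ^ 2 = ∑ i, ∑ j, Real.cosh (dist (v i) (v j)) := by
      simp only [h1, hA, hB, hC, Fin.sum_univ_three]
      ring
    rw [this]
    exact Finset.sum_pos (fun i _ => Finset.sum_pos (fun j _ => h2 i j) ⟨0, Finset.mem_univ _⟩)
      ⟨0, Finset.mem_univ _⟩
  have hs : 0 < √(A * C - B ^ 2) := Real.sqrt_pos.2 hAC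
  have hs2 := Real.sq_sqrt hAC.le
  refine ⟨⟨⟨B / C, √(A * C - B ^ 2) / C⟩, by positivity⟩, fun i => ?_⟩
  have h3 : (w i).a * A + (w i).b * B + (w i).c * C = (w i).height (v i) := by
    have h4 : (w i).a * A + (w i).b * B + (w i).c * C = ∑ k, (w i).height (v k) := by
      simp only [Wall.height_eq_hyperboloid, hA, hB, hC, Fin.sum_univ_three]
      ring
    rw [h4, Finset.sum_eq_single i (fun k _ hk => hzero i k hk.symm) (by simp)]
  have h5 : 0 < (w i).a * A + (w i).b * B + (w i).c * C := h3 ▸ hpos i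
  refine div_pos ?_ (by change 0 < √(A * C - B ^ 2) / C; positivity)
  change 0 < (w i).a * ((B / C) ^ 2 + (√(A * C - B ^ 2) / C) ^ 2) + (w i).b * (B / C) + (w i).c
  have h6 : (B / C) ^ 2 + (√(A * C - B ^ 2) / C) ^ 2 = A / C := by
    rw [div_pow, div_pow, hs2]
    field_simp
    ring
  rw [h6]
  have h7 : (w i).a * (A / C) + (w i).b * (B / C) + (w i).c =
      ((w i).a * A + (w i).b * B + (w i).c * C) / C := by
    field_simp
  rw [h7]
  positivity

/-- The closed triangle is bounded. -/
theorem exists_forall_dist_le :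
    ∃ r : ℝ, ∀ z : ℍ, (∀ i, 0 ≤ (w i).height z) → dist z (v 0) ≤ r := by
  refine ⟨∑ k, Real.cosh (dist (v k) (v 0)), fun z hz => ?_⟩
  set t : Fin 3 → ℝ := fun k => (w k).height z / (w k).height (v k) with ht
  have ht0 : ∀ k, 0 ≤ t k := fun k => div_nonneg (hz k) (hpos k).le
  have hP := hyperboloid_eq_sum hzero hpos z
  have hcosh : ∀ q, Real.cosh (dist z q) = ∑ k, t k * Real.cosh (dist (v k) q) := by
    intro q
    simp only [cosh_dist_eq_hyperboloid, hP, Fin.sum_univ_three]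
    ring
  -- The Lorentz norm of `z` in barycentric coordinates `t`; all terms are nonnegative, so each `t k
  -- ^ 2 ≤ 1`.
  have h1 : ∑ i, ∑ j, t i * t j * Real.cosh (dist (v i) (v j)) = 1 := by
    have h2 := hcosh z
    rw [dist_self, Real.cosh_zero] at h2
    rw [h2]
    refine Finset.sum_congr rfl fun i _ => ?_
    rw [dist_comm, hcosh, Finset.mul_sum]
    refine Finset.sum_congr rfl fun j _ => ?_
    rw [dist_comm (v j)]
    ring
  have ht1 : ∀ k, t k ≤ 1 := by
    intro k
    have hnn : ∀ i j, 0 ≤ t i * t j * Real.cosh (dist (v i) (v j)) := fun i j =>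
      mul_nonneg (mul_nonneg (ht0 i) (ht0 j)) (Real.cosh_pos _).le
    have h3 : t k * t k * Real.cosh (dist (v k) (v k)) ≤ 1 := by
      rw [← h1]
      exact (Finset.single_le_sum (fun j _ => hnn k j) (Finset.mem_univ k)).trans
        (Finset.single_le_sum (f := fun i => ∑ j, t i * t j * Real.cosh (dist (v i) (v j)))
          (fun i _ => Finset.sum_nonneg fun j _ => hnn i j) (Finset.mem_univ k))
    rw [dist_self, Real.cosh_zero, mul_one] at h3
    have := ht0 k
    nlinarith
  calc dist z (v 0) ≤ Real.sinh (dist z (v 0)) := Real.self_le_sinh_iff.2 dist_nonneg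
    _ ≤ Real.cosh (dist z (v 0)) := (Real.sinh_lt_cosh _).le
    _ = ∑ k, t k * Real.cosh (dist (v k) (v 0)) := hcosh _
    _ ≤ ∑ k, Real.cosh (dist (v k) (v 0)) :=
      Finset.sum_le_sum fun k _ => mul_le_of_le_one_left (Real.cosh_pos _).le (ht1 k)

/-- Every orbit of a group that contains the reflections in the sides meets a fixed compact set. -/
theorem exists_isCompact_forall_exists_mem :
    ∃ D : Set ℍ, IsCompact D ∧ ∀ Λ : Subgroup (Equiv.Perm ℍ), (∀ i, (w i).refl ∈ Λ) →
      ∀ x : ℍ, ∃ g ∈ Λ, g x ∈ D := by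
  obtain ⟨r, hr⟩ := exists_forall_dist_le hzero hpos
  obtain ⟨p, hp⟩ := exists_forall_height_pos hzero hpos
  -- The minimiser exists only in the closure of the orbit; the extra `1` leaves room for a genuine
  -- orbit point near it.
  refine ⟨Metric.closedBall (v 0) (r + 1), isCompact_closedBall _ _, fun Λ hΛ x => ?_⟩
  let O : Set ℍ := {y | ∃ g ∈ Λ, g x = y}
  have hne : (closure O).Nonempty := ⟨x, subset_closure ⟨1, Λ.one_mem, rfl⟩⟩
  obtain ⟨y, hy, hdist⟩ := isClosed_closure.exists_infDist_eq_dist hne p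
  have hyr : dist y (v 0) ≤ r := by
    refine hr y fun i => ?_
    have hcont : Continuous (w i).refl := continuous_const_smul (w i).toGL
    have hR : (w i).refl y ∈ closure O := by
      refine map_mem_closure hcont hy ?_
      rintro _ ⟨g, hg, rfl⟩
      exact ⟨(w i).refl * g, Λ.mul_mem (hΛ i) hg, rfl⟩
    have h1 : dist p y ≤ dist p ((w i).refl y) := hdist ▸ Metric.infDist_le_dist_of_mem hR
    have h2 : Real.cosh (dist p y) ≤ Real.cosh (dist p ((w i).refl y)) := by
      rwa [Real.cosh_le_cosh, abs_of_nonneg dist_nonneg, abs_of_nonneg dist_nonneg]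
    rw [cosh_dist_refl] at h2
    have := hp i
    by_contra! hcon
    nlinarith
  obtain ⟨_, ⟨g, hg, rfl⟩, hgy⟩ := Metric.mem_closure_iff.1 hy 1 one_pos
  refine ⟨g, hg, ?_⟩
  rw [Metric.mem_closedBall]
  have := dist_triangle (g x) y (v 0)
  rw [dist_comm (g x) y] at this
  linarith

end

/-! ### Möbius transformations fixing two points -/

/-- The point `i y` of the `y`-axis. -/
def axisPoint (y : ℝ) (hy : 0 < y) : ℍ := ⟨⟨0, y⟩, hy⟩

/-- Fixing `i y` means `g 0 1 = -(g 1 0) y ^ 2` and `g 0 0 = g 1 1`; two values of `y` kill the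
off-diagonal entries. -/
theorem eq_scalar_of_fixed {g : SL(2, ℝ)} (h1 : T g (axisPoint 1 one_pos) = axisPoint 1 one_pos)
    (h2 : T g (axisPoint 2 two_pos) = axisPoint 2 two_pos) :
    g 0 1 = 0 ∧ g 1 0 = 0 ∧ g 0 0 = g 1 1 := by
  have key : ∀ y (hy : 0 < y), T g (axisPoint y hy) = axisPoint y hy →
      g 0 1 = -(g 1 0 * y ^ 2) ∧ g 0 0 * y = g 1 1 * y := by
    intro y hy h
    have hden := UpperHalfPlane.denom_ne_zero (g : GL (Fin 2) ℝ) (axisPoint y hy)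
    have h' := coe_T_apply g (axisPoint y hy)
    rw [h, eq_div_iff (by simpa [UpperHalfPlane.denom] using! hden)] at h'
    have hre := congrArg Complex.re h'
    have him := congrArg Complex.im h'
    simp [axisPoint] at hre him
    constructor <;> linarith
  obtain ⟨a1, b1⟩ := key 1 one_pos h1
  obtain ⟨a2, b2⟩ := key 2 two_pos h2
  refine ⟨?_, ?_, ?_⟩ <;> linarith

/-- It fixes `i` and `2 i`, so a matrix inducing it would be scalar and act trivially; but `1 + i`
moves. -/
theorem yAxisReflection_not_mem_range : yAxisReflection ∉ T.range := by
  rintro ⟨g, hg⟩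
  have hfix : ∀ y (hy : 0 < y), T g (axisPoint y hy) = axisPoint y hy := by
    intro y hy
    ext
    rw [hg, coe_yAxisReflection_apply]
    apply Complex.ext <;> simp [axisPoint]
  obtain ⟨h01, h10, h00⟩ := eq_scalar_of_fixed (hfix 1 one_pos) (hfix 2 two_pos)
  have hdet : g 0 0 * g 1 1 - g 0 1 * g 1 0 = 1 := by
    have := g.det_coe
    rwa [Matrix.det_fin_two] at this
  have h11 : ((g 1 1 : ℝ) : ℂ) ≠ 0 := by
    intro h
    rw [Complex.ofReal_eq_zero] at h
    rw [h, h10] at hdet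
    simp at hdet
  let z : ℍ := ⟨⟨1, 1⟩, one_pos⟩
  have hz := coe_T_apply g z
  rw [hg, coe_yAxisReflection_apply, h01, h10, h00] at hz
  rw [Complex.ofReal_zero, zero_mul, zero_add, add_zero, mul_div_cancel_left₀ _ h11] at hz
  have := congrArg Complex.re hz
  simp [z] at this
  linarith

theorem reflection_not_mem_range {ℓ : Set ℍ} (hℓ : IsGeodesicLine ℓ) : reflection ℓ ∉ T.range := by
  obtain ⟨g, hg⟩ := exists_image_eq_yAxis hℓ
  rw [reflection_eq hg]
  rintro ⟨h, hh⟩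
  refine yAxisReflection_not_mem_range ⟨g * h * g⁻¹, ?_⟩
  rw [map_mul, map_mul, map_inv, hh]
  group

theorem eq_one_of_T_eq_one {g : SL(2, ℝ)} (h : T g = 1) (h00 : 0 < g 0 0) : g = 1 := by
  obtain ⟨h01, h10, h11⟩ := eq_scalar_of_fixed (g := g) (by rw [h]; rfl) (by rw [h]; rfl)
  have hdet : g 0 0 * g 1 1 - g 0 1 * g 1 0 = 1 := by
    have := g.det_coe
    rwa [Matrix.det_fin_two] at this
  rw [h01, ← h11] at hdet
  have h1 : g 0 0 = 1 := by nlinarith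
  ext i j
  fin_cases i <;> fin_cases j <;> simp [h01, h10, h1, ← h11]

/-! ### The reflection group of a triangle of walls -/

section

variable {w : Fin 3 → Wall} {n : Fin 3 → ℕ}

/-- The Coxeter matrix with entry `n k` for the reflections in the sides through the `k`-th
vertex. -/
def coxeterMatrix (n : Fin 3 → ℕ) (hn : ∀ k, 2 ≤ n k) : CoxeterMatrix (Fin 3) where
  -- For `i ≠ j` in `Fin 3` the third index is `-(i + j)`, because `0 + 1 + 2 = 0` modulo `3`.
  M := Matrix.of fun i j => if i = j then 1 else n (-(i + j))
  isSymm := by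
    ext i j
    simp only [Matrix.transpose_apply, Matrix.of_apply, eq_comm, add_comm]
  diagonal i := by simp
  off_diagonal i j h := by
    have := hn (-(i + j))
    simp only [Matrix.of_apply, if_neg h]
    lia

theorem coxeterMatrix_apply (hn : ∀ k, 2 ≤ n k) (i j : Fin 3) :
    coxeterMatrix n hn i j = if i = j then 1 else n (-(i + j)) := rfl

theorem pairing_eq_coxeterMatrix (hn : ∀ k, 2 ≤ n k)
    (hpair : ∀ i j, i ≠ j → (w i).pairing (w j) = -Real.cos (Real.pi / n (-(i + j))))
    (i j : Fin 3) :
    (w i).pairing (w j) = -Real.cos (Real.pi / coxeterMatrix n hn i j) := by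
  rw [coxeterMatrix_apply]
  split_ifs with h
  · rw [h, Wall.pairing_self]
    simp
  · exact hpair i j h

/-- A nontrivial element of the reflection group moves the open triangle off itself. -/
theorem exists_height_neg (hn : ∀ k, 2 ≤ n k)
    (hpair : ∀ i j, i ≠ j → (w i).pairing (w j) = -Real.cos (Real.pi / n (-(i + j))))
    {p : ℍ} (hp : ∀ i, 0 < (w i).height p) {g : Equiv.Perm ℍ}
    (hg : g ∈ Subgroup.closure (Set.range fun i => (w i).refl)) (hg1 : g ≠ 1) :
    ∃ i, (w i).height (g p) < 0 := by
  have hpair' := pairing_eq_coxeterMatrix hn hpair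
  have hlift : (coxeterMatrix n hn).IsLiftable fun i => (w i).refl := by
    intro i j
    by_cases h : i = j
    · rw [h, CoxeterMatrix.diagonal, pow_one, Wall.refl_mul_self]
    · rw [coxeterMatrix_apply, if_neg h]
      exact Wall.refl_mul_refl_pow _ _ (hn _) (hpair i j h)
  let cs := (coxeterMatrix n hn).toCoxeterSystem
  let f := cs.lift ⟨fun i => (w i).refl, hlift⟩
  have hf : ∀ i, f (cs.simple i) = (w i).refl := fun i => cs.lift_apply_simple hlift i
  obtain ⟨x, rfl⟩ : g ∈ f.range := by
    refine (Subgroup.closure_le _).2 ?_ hg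
    rintro _ ⟨i, rfl⟩
    exact ⟨_, hf i⟩
  -- The abstract Coxeter group acts through `f`. Its faithfulness is not needed: `g ≠ 1` already
  -- forces `x ≠ 1`.
  let _ : MulAction (coxeterMatrix n hn).Group ℍ := MulAction.compHom ℍ f
  have hsmul : ∀ x z, x • z = f x z := fun _ _ => rfl
  refine cs.exists_neg_of_ne_one (φ := fun i => (w i).height) (fun i j => ?_) (fun i j z => ?_)
    hp (fun h => hg1 (by rw [h, map_one]))
  · rw [coxeterMatrix_apply]
    split_ifs
    · exact one_ne_zero
    · have := hn (-(i + j))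
      lia
  · rw [hsmul, hf, Wall.height_refl, hpair']
    ring

end

namespace Wall

/-- Two sides of a triangle do not have the same normal vector at their common vertex. -/
theorem pairing_ne_one {w w' : Wall} {p q : ℍ} (hp : w.height p = 0) (hp' : w'.height p = 0)
    (hq : w.height q = 0) (hpos : 0 < w'.height q) : w.pairing w' ≠ 1 := by
  intro h
  have n1 := inner_normal_normal hp hp
  have n2 := inner_normal_normal hp' hp'
  have n3 := inner_normal_normal hp hp'
  rw [pairing_self] at n1 n2
  rw [h] at n3
  have i1 := inner_normal_direction hp q
  have i2 := inner_normal_direction hp' q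
  have hpq : 0 < p.im * q.im * w'.height q := by have := p.im_pos; have := q.im_pos; positivity
  -- Unit normals with inner product `1` coincide, yet the direction to `q` is orthogonal to one and
  -- not to the other.
  have hsum : ((w.normal p).re - (w'.normal p).re) ^ 2 +
      ((w.normal p).im - (w'.normal p).im) ^ 2 = 0 := by
    linear_combination n1 + n2 - 2 * n3
  have hre : (w.normal p).re = (w'.normal p).re := by nlinarith
  have him : (w.normal p).im = (w'.normal p).im := by nlinarith
  rw [hre, him, i2, hq] at i1
  linarith

theorem pairing_comm (w w' : Wall) : w.pairing w' = w'.pairing w := by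
  unfold pairing
  ring

end Wall

namespace Triangle

variable (𝒯 : Triangle)

theorem isGeodesicLine_sideLine (i : Fin 3) : IsGeodesicLine (𝒯.sideLine i) :=
  isGeodesicLine_geodesicThrough _ _

theorem vertex_mem_sideLine {i j : Fin 3} (h : i ≠ j) : 𝒯.vertex j ∈ 𝒯.sideLine i := by
  have : j = i + 1 ∨ j = i + 2 := by revert i j; decide
  rcases this with rfl | rfl
  · exact left_mem_geodesicThrough _ _
  · exact right_mem_geodesicThrough _ _

theorem vertex_not_mem_sideLine (i : Fin 3) : 𝒯.vertex i ∉ 𝒯.sideLine i := by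
  intro h
  refine 𝒯.not_collinear _ (𝒯.isGeodesicLine_sideLine i) fun j => ?_
  by_cases hij : i = j
  · exact hij ▸ h
  · exact 𝒯.vertex_mem_sideLine hij

/-- The sides of a triangle, oriented towards the opposite vertices. -/
theorem exists_walls : ∃ w : Fin 3 → Wall, (∀ i, 𝒯.R i = (w i).refl) ∧
    (∀ i j, i ≠ j → (w i).height (𝒯.vertex j) = 0) ∧ ∀ i, 0 < (w i).height (𝒯.vertex i) := by
  have h : ∀ i, ∃ w : Wall, 𝒯.R i = w.refl ∧
      (∀ j, i ≠ j → w.height (𝒯.vertex j) = 0) ∧ 0 < w.height (𝒯.vertex i) := by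
    intro i
    obtain ⟨w, hw, hmem⟩ := Wall.exists_wall (𝒯.isGeodesicLine_sideLine i)
    have hzero : ∀ j, i ≠ j → w.height (𝒯.vertex j) = 0 := fun j hij =>
      (hmem _).1 (𝒯.vertex_mem_sideLine hij)
    have hne : w.height (𝒯.vertex i) ≠ 0 := fun h =>
      𝒯.vertex_not_mem_sideLine i ((hmem _).2 h)
    rcases hne.lt_or_gt with hlt | hgt
    · refine ⟨w.neg, by rw [Wall.refl_neg]; exact hw, fun j hij => ?_, ?_⟩
      · rw [Wall.height_neg, hzero j hij, neg_zero]
      · rw [Wall.height_neg]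
        linarith
    · exact ⟨w, hw, hzero, hgt⟩
  choose w h1 h2 h3 using h
  exact ⟨w, h1, h2, h3⟩

variable {𝒯}

theorem pairing_eq_neg_cos {w : Fin 3 → Wall} {n : Fin 3 → ℕ}
    (hangle : ∀ i, 𝒯.angle i = Real.pi / n i)
    (hzero : ∀ i j, i ≠ j → (w i).height (𝒯.vertex j) = 0)
    (hpos : ∀ i, 0 < (w i).height (𝒯.vertex i)) {i j : Fin 3} (hij : i ≠ j) :
    (w i).pairing (w j) = -Real.cos (Real.pi / n (-(i + j))) := by
  have key : ∀ k : Fin 3, (w (k + 2)).pairing (w (k + 1)) = -Real.cos (Real.pi / n k) := by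
    intro k
    rw [← hangle k]
    have h1 : k + 2 ≠ k := by revert k; decide
    have h2 : k + 1 ≠ k := by revert k; decide
    have h3 : k + 2 ≠ k + 1 := by revert k; decide
    exact Wall.pairing_eq_neg_cos_angle (hzero _ _ h1) (hzero _ _ h2) (hzero _ _ h3)
      (hzero _ _ h3.symm) (hpos _) (hpos _)
  have h : i = -(i + j) + 2 ∧ j = -(i + j) + 1 ∨ i = -(i + j) + 1 ∧ j = -(i + j) + 2 := by
    revert i j; decide
  rcases h with ⟨h1, h2⟩ | ⟨h1, h2⟩
  · have := key (-(i + j))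
    rwa [← h1, ← h2] at this
  · have := key (-(i + j))
    rwa [← h1, ← h2, Wall.pairing_comm] at this

/-- An angle `π` would give pairing `1`, which `pairing_ne_one` excludes. -/
theorem two_le_of_angle {w : Fin 3 → Wall} {n : Fin 3 → ℕ} (hn : ∀ i, 0 < n i)
    (hangle : ∀ i, 𝒯.angle i = Real.pi / n i)
    (hzero : ∀ i j, i ≠ j → (w i).height (𝒯.vertex j) = 0)
    (hpos : ∀ i, 0 < (w i).height (𝒯.vertex i)) (k : Fin 3) : 2 ≤ n k := by
  have h2 : k + 2 ≠ k := by clear hn hangle hzero hpos; revert k; decide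
  have h3 : k + 1 ≠ k := by clear hn hangle hzero hpos; revert k; decide
  have h4 : k + 2 ≠ k + 1 := by clear hn hangle hzero hpos; revert k; decide
  have h5 : -(k + 2 + (k + 1)) = k := by clear hn hangle hzero hpos; revert k; decide
  by_contra hlt
  have h1 : n k = 1 := by have := hn k; lia
  refine Wall.pairing_ne_one (hzero _ _ h2) (hzero _ _ h3) (hzero _ _ h4) (hpos _) ?_
  rw [pairing_eq_neg_cos hangle hzero hpos h4, h5, h1]
  simp

/-! ### The even subgroup -/

variable (𝒯)

theorem prod_mem_reflectionGroup (l : List (Fin 3)) : (l.map 𝒯.R).prod ∈ 𝒯.reflectionGroup := by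
  refine Subgroup.list_prod_mem _ fun x hx => ?_
  obtain ⟨i, -, rfl⟩ := List.mem_map.1 hx
  exact Subgroup.subset_closure ⟨i, rfl⟩

theorem exists_list_of_mem {g : Equiv.Perm ℍ} (hg : g ∈ 𝒯.reflectionGroup) :
    ∃ l : List (Fin 3), (l.map 𝒯.R).prod = g := by
  induction hg using Subgroup.closure_induction with
  | mem x hx =>
    obtain ⟨i, rfl⟩ := hx
    exact ⟨[i], by simp⟩
  | one => exact ⟨[], rfl⟩
  | mul x y _ _ hx hy =>
    obtain ⟨l, rfl⟩ := hx
    obtain ⟨l', rfl⟩ := hy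
    exact ⟨l ++ l', by simp⟩
  | inv x _ hx =>
    obtain ⟨l, rfl⟩ := hx
    refine ⟨l.reverse, ?_⟩
    have hR : (fun x => x⁻¹) ∘ 𝒯.R = 𝒯.R :=
      funext fun i => inv_eq_of_mul_eq_one_left (reflection_mul_self _)
    rw [List.prod_inv_reverse, List.map_map, hR, List.map_reverse]

theorem evenSubgroup_le_reflectionGroup : 𝒯.evenSubgroup ≤ 𝒯.reflectionGroup := by
  rintro _ ⟨l, -, rfl⟩
  exact 𝒯.prod_mem_reflectionGroup l

theorem R_mul_mem_or_mem {g : Equiv.Perm ℍ} (hg : g ∈ 𝒯.reflectionGroup) (i : Fin 3) :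
    g ∈ 𝒯.evenSubgroup ∨ 𝒯.R i * g ∈ 𝒯.evenSubgroup := by
  obtain ⟨l, rfl⟩ := 𝒯.exists_list_of_mem hg
  by_cases hl : Even l.length
  · exact Or.inl ⟨l, hl, rfl⟩
  · exact Or.inr ⟨i :: l, by rwa [List.length_cons, Nat.even_add_one], by simp⟩

theorem evenSubgroup_le_range : 𝒯.evenSubgroup ≤ T.range := by
  obtain ⟨w, hR, -, -⟩ := 𝒯.exists_walls
  rintro _ ⟨l, hl, rfl⟩
  have hprod : ∀ l : List (Fin 3), ∃ A : GL (Fin 2) ℝ, A.det = (-1) ^ l.length ∧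
      (l.map 𝒯.R).prod = MulAction.toPermHom (GL (Fin 2) ℝ) ℍ A := by
    intro l
    induction l with
    | nil => exact ⟨1, by simp, (map_one _).symm⟩
    | cons i l ih =>
      obtain ⟨A, hA, hprod⟩ := ih
      refine ⟨(w i).toGL * A, ?_, ?_⟩
      · rw [map_mul, hA, Wall.det_toGL, List.length_cons, pow_succ']
      · rw [List.map_cons, List.prod_cons, hprod, map_mul, hR]
        rfl
  obtain ⟨A, hA, hAl⟩ := hprod l
  rw [hl.neg_one_pow] at hA
  obtain ⟨g, rfl⟩ : A ∈ Set.range Matrix.SpecialLinearGroup.toGL := by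
    rw [Matrix.SpecialLinearGroup.range_toGL]
    exact hA
  exact ⟨g, hAl.symm⟩

theorem R_not_mem_evenSubgroup (i : Fin 3) : 𝒯.R i ∉ 𝒯.evenSubgroup := fun h =>
  reflection_not_mem_range (𝒯.isGeodesicLine_sideLine i) (𝒯.evenSubgroup_le_range h)

/-- Word parity gives at most two cosets, with `𝒯.R 0` representing the second; they differ because
no reflection is a Möbius map from `SL(2, ℝ)`. -/
theorem relIndex_evenSubgroup : 𝒯.evenSubgroup.relIndex 𝒯.reflectionGroup = 2 := by
  have hR : 𝒯.R 0 ∈ 𝒯.reflectionGroup := Subgroup.subset_closure ⟨0, rfl⟩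
  rw [Subgroup.relIndex, Subgroup.index_eq_two_iff']
  refine ⟨⟨𝒯.R 0, hR⟩, fun ⟨g, hg⟩ => ?_⟩
  simp only [Subgroup.mem_subgroupOf, Subgroup.coe_mul]
  rcases 𝒯.R_mul_mem_or_mem hg 0 with h | h
  · refine Or.inr ⟨h, fun h' => 𝒯.R_not_mem_evenSubgroup 0 ?_⟩
    simpa using 𝒯.evenSubgroup.mul_mem h' (𝒯.evenSubgroup.inv_mem h)
  · refine Or.inl ⟨h, fun h' => 𝒯.R_not_mem_evenSubgroup 0 ?_⟩
    simpa using 𝒯.evenSubgroup.mul_mem h (𝒯.evenSubgroup.inv_mem h')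

/-! ### The triangle group -/

theorem exists_isCompact_forall_mul_mem :
    ∃ K : Set SL(2, ℝ), IsCompact K ∧ ∀ g, ∃ γ ∈ 𝒯.Γ, γ * g ∈ K := by
  obtain ⟨w, hR, hzero, hpos⟩ := 𝒯.exists_walls
  obtain ⟨D, hD, hcov⟩ := exists_isCompact_forall_exists_mem hzero hpos
  have hcont : Continuous (w 0).refl := continuous_const_smul (w 0).toGL
  -- Orbits of the full group meet `D`; an odd word is made even by one more reflection, hence the
  -- union with the mirror image. Properness of `g ↦ g • I` lifts compactness to the group.
  refine ⟨_, isProperMap_smul_I.isCompact_preimage (hD.union (hD.image hcont)), fun g => ?_⟩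
  obtain ⟨x, hx, hxD⟩ := hcov 𝒯.reflectionGroup
    (fun i => hR i ▸ Subgroup.subset_closure ⟨i, rfl⟩) (g • I)
  obtain ⟨y, hy, hyD⟩ : ∃ y ∈ 𝒯.evenSubgroup, y (g • I) ∈ D ∪ (w 0).refl '' D := by
    rcases 𝒯.R_mul_mem_or_mem hx 0 with h | h
    · exact ⟨x, h, Or.inl hxD⟩
    · exact ⟨_, h, Or.inr ⟨_, hxD, by rw [hR]; rfl⟩⟩
  obtain ⟨γ, rfl⟩ := 𝒯.evenSubgroup_le_range hy
  refine ⟨γ, hy, ?_⟩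
  rw [Set.mem_preimage, mul_smul]
  exact hyD

theorem discreteTopology_Γ {n : Fin 3 → ℕ} (hn : ∀ i, 0 < n i)
    (hangle : ∀ i, 𝒯.angle i = Real.pi / n i) : DiscreteTopology 𝒯.Γ := by
  obtain ⟨w, hR, hzero, hpos⟩ := 𝒯.exists_walls
  obtain ⟨p, hp⟩ := exists_forall_height_pos hzero hpos
  refine discreteTopology_of_isOpen_singleton_one ?_
  have hheight : ∀ i, Continuous (w i).height := fun i => by
    unfold Wall.height
    have h1 : Continuous fun z : ℍ => z.re := continuous_re
    have h2 : Continuous fun z : ℍ => z.im := continuous_im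
    exact Continuous.div (by fun_prop) h2 fun z => z.im_ne_zero
  -- The height conditions force `T g = 1` on `Γ`; the sign of `g 0 0` separates `1` from `-1`.
  let U : Set SL(2, ℝ) := {g | 0 < g 0 0} ∩ ⋂ i, {g | 0 < (w i).height (g • p)}
  have hU : IsOpen U := by
    refine IsOpen.inter (isOpen_lt continuous_const (by fun_prop))
      (isOpen_iInter_of_finite fun i => isOpen_lt continuous_const ?_)
    exact (hheight i).comp (continuous_id.smul continuous_const)
  convert hU.preimage continuous_subtype_val
  ext ⟨g, hg⟩
  simp only [Set.mem_singleton_iff, Set.mem_preimage]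
  constructor
  · intro h
    obtain rfl : g = 1 := congrArg Subtype.val h
    exact ⟨by simp, Set.mem_iInter.2 fun i => by simpa using hp i⟩
  · rintro ⟨h00, hgp⟩
    refine Subtype.ext (eq_one_of_T_eq_one ?_ h00)
    by_contra hne
    have hmem : T g ∈ Subgroup.closure (Set.range fun i => (w i).refl) := by
      have := 𝒯.evenSubgroup_le_reflectionGroup hg
      rwa [reflectionGroup, funext hR] at this
    obtain ⟨i, hi⟩ := exists_height_neg (two_le_of_angle hn hangle hzero hpos)
      (fun i j hij => pairing_eq_neg_cos hangle hzero hpos hij) hp hmem hne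
    exact (lt_asymm hi) (Set.mem_iInter.1 hgp i)

end Triangle

end TriangleGroup

end

theorem mainTheorem12 (𝒯 : TriangleGroup.Triangle) (n : Fin 3 → ℕ) (hn : ∀ i, 0 < n i)
    (hangle : ∀ i, 𝒯.angle i = Real.pi / n i)
    [MeasurableSpace SL(2, ℝ)] [BorelSpace SL(2, ℝ)]
    (m : Measure SL(2, ℝ)) [m.IsHaarMeasure] :
    𝒯.evenSubgroup ≤ 𝒯.reflectionGroup ∧
      𝒯.evenSubgroup.relIndex 𝒯.reflectionGroup = 2 ∧
      𝒯.evenSubgroup ≤ TriangleGroup.T.range ∧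
      TriangleGroup.IsLattice m 𝒯.Γ ∧
      TriangleGroup.IsCocompact 𝒯.Γ := by
  have hloc : LocallyCompactSpace (Matrix (Fin 2) (Fin 2) ℝ) :=
    inferInstanceAs (LocallyCompactSpace (Fin 2 → Fin 2 → ℝ))
  have hSL : LocallyCompactSpace SL(2, ℝ) :=
    Matrix.SpecialLinearGroup.isClosedEmbedding_val.locallyCompactSpace
  have hm : IsLocallyFiniteMeasure m := isLocallyFiniteMeasure_of_isFiniteMeasureOnCompacts
  have hΓ := 𝒯.discreteTopology_Γ hn hangle
  obtain ⟨K, hK, hcov⟩ := 𝒯.exists_isCompact_forall_mul_mem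
  exact ⟨𝒯.evenSubgroup_le_reflectionGroup, 𝒯.relIndex_evenSubgroup, 𝒯.evenSubgroup_le_range,
    TriangleGroup.isLattice_of_isCompact m hK hcov, TriangleGroup.isCocompact_of_isCompact hK hcov⟩
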